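/- Let $K$ be an algebraically closed field and let $\Gamma$ be the quiver with vertices $0,1,2,3$ (read modulo $4$) and eight arrows $a_i, b_i : i \to i+1$ for $0\le i\le 3$. Paths are written from left to right. In the path algebra $K\Gamma$ put $x=\sum_{i=0}^{3}a_i$ and $y=\sum_{i=0}^{3}b_i$, and let $A_0 = K\Gamma/\langle xy,\ x^2+y^2,\ yx\rangle$, the quotient by the two-sided ideal generated by these elements. Then $A_0$ is a self-injective Koszul algebra. That is: 1. $A_0$ is finite-dimensional over $K$ and is injective as a left and as a right module over itself. 2. For $n \ge 0$ let $(A_0)_n$ be the span of the residue classes of the paths of length $n$. Then $A_0=\bigoplus_{n\ge 0}(A_0)_n$ is a graded algebra with $(A_0)_0$ semisimple, its Jacobson radical is $\mathfrak r=\bigoplus_{n\ge 1}(A_0)_n$, and the right module $A_0/\mathfrak r$, placed in degree $0$, has a linear resolution: there is an exact sequence $$\cdots\to P^2\to P^1\to P^0\to A_0/\mathfrak r\to 0$$ of graded right $A_0$-modules and homomorphisms of degree $0$ in which each $P^n$ is projective and is generated by its elements of degree $n$. -/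

import Mathlib

universe u

/-! ### The path algebra of a finite quiver -/

/-- The set of all paths of a quiver, including the trivial path at every vertex: an element
`⟨i, j, p⟩` is a path `p` with origin `i` and terminus `j`. -/
abbrev AllPaths (V : Type) [Quiver.{0} V] : Type :=
  Σ i j : V, Quiver.Path i j

/-- The path algebra `KΓ`: the vector space with basis the set of all paths. -/
def PathAlgebra (K : Type u) (V : Type) [Field K] [Quiver.{0} V] : Type u :=
  AllPaths V →₀ K

namespace PathAlgebra

variable {K : Type u} {V : Type} [Field K] [Quiver.{0} V]

noncomputable instance : AddCommGroup (PathAlgebra K V) :=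
  inferInstanceAs (AddCommGroup (AllPaths V →₀ K))

noncomputable instance : Module K (PathAlgebra K V) :=
  inferInstanceAs (Module K (AllPaths V →₀ K))

/-- A path, as a basis element of the path algebra. -/
noncomputable def ofPath (p : AllPaths V) : PathAlgebra K V :=
  (Finsupp.single p (1 : K) : AllPaths V →₀ K)

variable (K V) in
/-- The basis of the path algebra given by the paths. -/
noncomputable def pathBasis : Module.Basis (AllPaths V) K (PathAlgebra K V) :=
  Module.Basis.ofRepr (LinearEquiv.refl K (AllPaths V →₀ K))

lemma pathBasis_apply (p : AllPaths V) : pathBasis K V p = ofPath p := rfl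

variable [DecidableEq V]

/-- The product of two paths, written from left to right: the concatenation `pq` if the terminus
of `p` is the origin of `q`, and `0` otherwise. -/
noncomputable def mulPath (p q : AllPaths V) : PathAlgebra K V :=
  if h : q.1 = p.2.1 then ofPath ⟨p.1, q.2.1, p.2.2.comp (q.2.2.cast h rfl)⟩ else 0

variable (K V) in
/-- The bilinear extension of the product of paths. -/
noncomputable def mulBilin : PathAlgebra K V →ₗ[K] PathAlgebra K V →ₗ[K] PathAlgebra K V :=
  (pathBasis K V).constr K fun p => (pathBasis K V).constr K fun q => mulPath p q

noncomputable instance : Mul (PathAlgebra K V) :=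
  ⟨fun f g => mulBilin K V f g⟩

lemma mul_def (f g : PathAlgebra K V) : f * g = mulBilin K V f g := rfl

lemma ofPath_mul_ofPath (p q : AllPaths V) :
    (ofPath p * ofPath q : PathAlgebra K V) = mulPath p q := by
  rw [mul_def, ← pathBasis_apply, ← pathBasis_apply, mulBilin, Module.Basis.constr_basis,
    Module.Basis.constr_basis]

lemma ofPath_mul_comp {i j k : V} (p : Quiver.Path i j) (q : Quiver.Path j k) :
    (ofPath ⟨i, j, p⟩ * ofPath ⟨j, k, q⟩ : PathAlgebra K V) = ofPath ⟨i, k, p.comp q⟩ := by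
  rw [ofPath_mul_ofPath, mulPath, dif_pos rfl]
  rfl

lemma ofPath_mul_of_ne {i j k l : V} (p : Quiver.Path i j) (q : Quiver.Path k l) (h : k ≠ j) :
    (ofPath ⟨i, j, p⟩ * ofPath ⟨k, l, q⟩ : PathAlgebra K V) = 0 := by
  rw [ofPath_mul_ofPath, mulPath, dif_neg h]

lemma mul_assoc_ofPath (p q r : AllPaths V) :
    (ofPath p * ofPath q * ofPath r : PathAlgebra K V) = ofPath p * (ofPath q * ofPath r) := by
  obtain ⟨i, j, p⟩ := p
  obtain ⟨k, l, q⟩ := q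
  obtain ⟨m, n, r⟩ := r
  have zl : ∀ f : PathAlgebra K V, 0 * f = 0 := fun f => by simp [mul_def]
  have zr : ∀ f : PathAlgebra K V, f * 0 = 0 := fun f => by simp [mul_def]
  by_cases h : k = j
  · subst h
    by_cases h' : m = l
    · subst h'
      simp only [ofPath_mul_comp, Quiver.Path.comp_assoc]
    · rw [ofPath_mul_comp, ofPath_mul_of_ne _ _ h', ofPath_mul_of_ne _ _ h', zr]
  · rw [ofPath_mul_of_ne _ _ h, zl]
    by_cases h' : m = l
    · subst h'
      rw [ofPath_mul_comp, ofPath_mul_of_ne _ _ h]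
    · rw [ofPath_mul_of_ne _ _ h', zr]

variable [Fintype V]

/-- The unit of the path algebra is the sum of the trivial paths. -/
noncomputable instance : One (PathAlgebra K V) :=
  ⟨∑ i : V, ofPath ⟨i, i, Quiver.Path.nil⟩⟩

set_option linter.unusedSectionVars false in
lemma one_def : (1 : PathAlgebra K V) = ∑ i : V, ofPath ⟨i, i, Quiver.Path.nil⟩ := rfl

noncomputable instance : Ring (PathAlgebra K V) :=
  { (inferInstance : AddCommGroup (PathAlgebra K V)),
    (inferInstance : Mul (PathAlgebra K V)),
    (inferInstance : One (PathAlgebra K V)) with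
    left_distrib := fun f g h => by simp [mul_def]
    right_distrib := fun f g h => by simp [mul_def]
    zero_mul := fun f => by simp [mul_def]
    mul_zero := fun f => by simp [mul_def]
    mul_assoc := by
      have key : (mulBilin K V).compr₂ (mulBilin K V) =
          ((LinearMap.llcomp K _ _ _).flip (mulBilin K V)).comp
            ((LinearMap.llcomp K _ _ _).comp (mulBilin K V)) := by
        refine (pathBasis K V).ext fun p => (pathBasis K V).ext fun q =>
          (pathBasis K V).ext fun r => ?_
        exact mul_assoc_ofPath p q r
      intro f g h
      exact congrArg (fun t => t f g h) key
    one_mul := by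
      have key : mulBilin K V 1 = LinearMap.id := by
        refine (pathBasis K V).ext fun p => ?_
        change (1 : PathAlgebra K V) * ofPath p = ofPath p
        obtain ⟨i, j, p⟩ := p
        rw [one_def, mul_def, map_sum, LinearMap.sum_apply, Finset.sum_eq_single i]
        · rw [← mul_def, ofPath_mul_comp, Quiver.Path.nil_comp]
        · intro k _ hk
          rw [← mul_def, ofPath_mul_of_ne _ _ hk.symm]
        · intro h
          exact absurd (Finset.mem_univ i) h
      intro f
      exact congrArg (fun t => t f) key
    mul_one := by
      have key : (mulBilin K V).flip 1 = LinearMap.id := by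
        refine (pathBasis K V).ext fun p => ?_
        change ofPath p * (1 : PathAlgebra K V) = ofPath p
        obtain ⟨i, j, p⟩ := p
        rw [one_def, mul_def, map_sum, Finset.sum_eq_single j]
        · rw [← mul_def, ofPath_mul_comp, Quiver.Path.comp_nil]
        · intro k _ hk
          rw [← mul_def, ofPath_mul_of_ne _ _ hk]
        · intro h
          exact absurd (Finset.mem_univ j) h
      intro f
      exact congrArg (fun t => t f) key }

noncomputable instance : Algebra K (PathAlgebra K V) :=
  Algebra.ofModule (fun r f g => by simp [mul_def]) (fun r f g => by simp [mul_def])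

end PathAlgebra

/-! ### The quiver `Γ` and the algebras `A_T` -/

/-- The four vertices `0, 1, 2, 3` of `Γ`, read modulo `4`. -/
def Gam : Type := ZMod 4

instance : DecidableEq Gam := inferInstanceAs (DecidableEq (ZMod 4))

instance : Fintype Gam := inferInstanceAs (Fintype (ZMod 4))

instance : CommRing Gam := inferInstanceAs (CommRing (ZMod 4))

/-- The eight arrows of `Γ`: for each vertex `i` two arrows `a i` and `b i` from `i` to `i + 1`. -/
inductive GamArrow : Gam → Gam → Type
  | a (i : Gam) : GamArrow i (i + 1)
  | b (i : Gam) : GamArrow i (i + 1)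

instance : Quiver.{0} Gam := ⟨GamArrow⟩

/-- An arrow of `Γ` as an element of the path algebra. -/
noncomputable def ofArrow (K : Type u) [Field K] {i j : Gam} (c : i ⟶ j) : PathAlgebra K Gam :=
  PathAlgebra.ofPath ⟨i, j, c.toPath⟩

/-- `x = a₀ + a₁ + a₂ + a₃`. -/
noncomputable def elemX (K : Type u) [Field K] : PathAlgebra K Gam :=
  ∑ i : Gam, ofArrow K (GamArrow.a i : i ⟶ i + 1)

/-- `y = b₀ + b₁ + b₂ + b₃`. -/
noncomputable def elemY (K : Type u) [Field K] : PathAlgebra K Gam :=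
  ∑ i : Gam, ofArrow K (GamArrow.b i : i ⟶ i + 1)

/-- The two-sided ideal `I_T` generated by `xy`, `x ^ (4T+2) + y ^ (4T+2)` and `yx`. -/
noncomputable def idealI (K : Type u) [Field K] (T : ℕ) : TwoSidedIdeal (PathAlgebra K Gam) :=
  TwoSidedIdeal.span
    {elemX K * elemY K, elemX K ^ (4 * T + 2) + elemY K ^ (4 * T + 2), elemY K * elemX K}

/-- The algebra `A_T = KΓ / I_T`. -/
abbrev AlgA (K : Type u) [Field K] (T : ℕ) : Type u :=
  (idealI K T).ringCon.Quotient

/-- The projection `KΓ → A_T`. -/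
noncomputable def projA (K : Type u) [Field K] (T : ℕ) : PathAlgebra K Gam →ₗ[K] AlgA K T where
  toFun f := (f : (idealI K T).ringCon.Quotient)
  map_add' _ _ := rfl
  map_smul' _ _ := rfl

/-- The degree `n` part of `A_T` for path length: the span of the classes of the paths of
length `n`. -/
noncomputable def lengthPart (K : Type u) [Field K] (T : ℕ) (n : ℕ) : Submodule K (AlgA K T) :=
  Submodule.span K {z | ∃ p : AllPaths Gam, p.2.2.length = n ∧ z = projA K T (PathAlgebra.ofPath p)}

/-! ### Self-injective algebras -/

/-- A ring is self-injective if it is injective as a left and as a right module over itself. -/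
def IsSelfInjective (R : Type u) [Ring R] : Prop :=
  Module.Injective R R ∧ Module.Injective Rᵐᵒᵖ R

/-! ### Koszul algebras

Right modules over `A` are modules over `Aᵐᵒᵖ`, as usual in Mathlib. -/

section Koszul

variable {K A : Type u} [Field K] [Ring A] [Algebra K A]

/-- The right ideal of `A` generated by the homogeneous elements of positive degree, that is,
`⨁_{n ≥ 1} A_n`. -/
def positivePart (𝒜 : ℕ → Submodule K A) : Submodule Aᵐᵒᵖ A :=
  Submodule.span Aᵐᵒᵖ {z | ∃ n, 1 ≤ n ∧ z ∈ 𝒜 n}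

/-- A linear resolution of a right `A`-module `M`, where `M` is put in degree `0`: an exact sequence
`⋯ → P 2 → P 1 → P 0 → M → 0` of graded right `A`-modules and homomorphisms of degree `0`, in which
`P n` is projective and generated by its elements of degree `n`. -/
structure LinearResolution (𝒜 : ℕ → Submodule K A) (M : Type u) [AddCommGroup M]
    [Module Aᵐᵒᵖ M] where
  P : ℕ → Type u
  [addCommGroup : ∀ n, AddCommGroup (P n)]
  [module : ∀ n, Module Aᵐᵒᵖ (P n)]
  /-- `deg n i` is the homogeneous part of degree `i` of `P n`. -/
  deg : ∀ n, ℕ → AddSubgroup (P n)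
  isInternal : ∀ n, DirectSum.IsInternal (deg n)
  smul_mem : ∀ (n i j : ℕ) (m : P n) (z : A),
    m ∈ deg n i → z ∈ 𝒜 j → MulOpposite.op z • m ∈ deg n (i + j)
  projective : ∀ n, Module.Projective Aᵐᵒᵖ (P n)
  generated : ∀ n, Submodule.span Aᵐᵒᵖ (deg n n : Set (P n)) = ⊤
  d : ∀ n, P (n + 1) →ₗ[Aᵐᵒᵖ] P n
  d_mem : ∀ (n i : ℕ) (m : P (n + 1)), m ∈ deg (n + 1) i → d n m ∈ deg n i
  ε : P 0 →ₗ[Aᵐᵒᵖ] M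
  ε_eq_zero : ∀ (i : ℕ) (m : P 0), i ≠ 0 → m ∈ deg 0 i → ε m = 0
  surjective : Function.Surjective ε
  exact_zero : Function.Exact (d 0) ε
  exact_succ : ∀ n, Function.Exact (d (n + 1)) (d n)

/-- A graded algebra `A = ⨁_{n ≥ 0} A_n` is Koszul if `A_0` is semisimple and the graded right
module `A / ⨁_{n ≥ 1} A_n` (which is `A_0` in degree `0`) has a linear resolution. -/
def IsKoszul (𝒜 : ℕ → Submodule K A) [GradedAlgebra 𝒜] : Prop :=
  IsSemisimpleRing (𝒜 0) ∧ Nonempty (LinearResolution 𝒜 (A ⧸ positivePart 𝒜))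

end Koszul

/-!
The algebra `A₀` is a four-vertex version of `Λ = K⟨x, y⟩ / (xy, x² + y², yx)`, which has basis
`1, x, y, x²`. Since `e_i x = x e_{i+1}` and `e_i y = y e_{i+1}`, the elements `w e_j`, with `w` one
of `1, x, y, x²` and `j` a vertex, span `A₀`. They are linearly independent because the regular
representation of `Λ` yields a representation of `A₀` by `4 × 4` block matrices (`rep`). Hence
`A₀` is a free left `Λ`-module on the span of the `e_j`; this is recorded by the structure
`LeftCoords`, and `leftCoords` is the instance of it for `A₀`.

*Self-injectivity.* Let `φ` sum the coefficients of the elements `x² e_j`. The bilinear form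
`φ (b * a)` is nondegenerate (`eq_zero_of_socleForm`), so `A₀` is isomorphic to its dual on both
sides, and Baer's criterion applies by extending linear forms (`IsSelfInjective.of_linearForm`).

*Radical.* The part of degree `0` is `K ^ 4`, and projecting to it is a ring homomorphism whose
kernel `⨁_{n ≥ 1} A_n` consists of nilpotent elements (`mem_positivePart`, `mem_jacobson`).

*Koszulity.* The quadratic dual of `Λ` is `K⟨x, y⟩ / (x² - y²)`, with `n + 1` basis elements in
degree `n`. Accordingly `P n = A₀(-n) ^ (n + 1)`, and the differentials are left multiplications by
the bidiagonal matrices with rows `(…, x, y, …)` for even `n` and `(…, y, x, …)` for odd `n`.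
Exactness is read off from the coordinates (`LeftCoords.exact_bidiag`).
-/

/-! ### Words along paths -/

/-- The value of an arrow of `Γ` when every `a i` is read as `x` and every `b i` as `y`. -/
def arrowValue {R : Type*} (x y : R) : {i j : Gam} → GamArrow i j → R
  | _, _, .a _ => x
  | _, _, .b _ => y

lemma arrowValue_eq_or {R : Type*} (x y : R) {i j : Gam} (c : GamArrow i j) :
    arrowValue x y c = x ∨ arrowValue x y c = y := by
  cases c
  · exact Or.inl rfl
  · exact Or.inr rfl

/-- The word in `x` and `y` spelled by a path of `Γ`, evaluated in a monoid. -/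
def pathWord {R : Type*} [Monoid R] (x y : R) {i : Gam} : {j : Gam} → Quiver.Path i j → R
  | _, .nil => 1
  | _, .cons p c => pathWord x y p * arrowValue x y c

lemma pathWord_comp {R : Type*} [Monoid R] (x y : R) {i j k : Gam} (p : Quiver.Path i j)
    (q : Quiver.Path j k) : pathWord x y (p.comp q) = pathWord x y p * pathWord x y q := by
  induction q with
  | nil => simp [pathWord]
  | cons q c ih => simp [pathWord, ih, mul_assoc]

section Relations

variable {R : Type*} [Ring R] {x y : R}

lemma pathWord_of_length_eq_zero {i j : Gam} (p : Quiver.Path i j) (hp : p.length = 0) :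
    pathWord x y p = 1 := by
  cases p with
  | nil => rfl
  | cons p c => simp at hp

lemma pathWord_of_length_eq_one {i j : Gam} (p : Quiver.Path i j) (hp : p.length = 1) :
    pathWord x y p = x ∨ pathWord x y p = y := by
  cases p with
  | nil => simp at hp
  | cons p c =>
    rw [pathWord, pathWord_of_length_eq_zero p (by simpa using hp)]
    simpa using arrowValue_eq_or x y c

lemma pathWord_of_length_eq_two (hxy : x * y = 0) (hyx : y * x = 0) (h : x * x + y * y = 0)
    {i j : Gam} (p : Quiver.Path i j) (hp : p.length = 2) :
    pathWord x y p = x * x ∨ pathWord x y p = -(x * x) ∨ pathWord x y p = 0 := by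
  have hy : y * y = -(x * x) := (neg_eq_of_add_eq_zero_right h).symm
  cases p with
  | nil => simp at hp
  | cons p c =>
    rcases pathWord_of_length_eq_one (x := x) (y := y) p (by simpa using hp) with h' | h' <;>
      rcases arrowValue_eq_or x y c with hc | hc <;> simp [pathWord, h', hc, hxy, hyx, hy]

lemma pathWord_of_three_le_length (hxy : x * y = 0) (hyx : y * x = 0) (h : x * x + y * y = 0)
    {i j : Gam} (p : Quiver.Path i j) (hp : 3 ≤ p.length) : pathWord x y p = 0 := by
  have hy : y * y = -(x * x) := (neg_eq_of_add_eq_zero_right h).symm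
  -- `x ^ 3 = -x y ^ 2 = 0`, and the other products of length three contain `xy` or `yx`
  have hxxx : x * x * x = 0 := by
    rw [← neg_eq_zero, ← neg_mul, ← hy, mul_assoc, hyx, mul_zero]
  have hxxy : x * x * y = 0 := by rw [mul_assoc, hxy, mul_zero]
  induction p with
  | nil => simp at hp
  | cons p c ih =>
    rw [pathWord]
    rcases Nat.lt_or_ge p.length 3 with h3 | h3
    · rcases pathWord_of_length_eq_two hxy hyx h p (by simp at hp; omega) with h' | h' | h' <;>
        rcases arrowValue_eq_or x y c with hc | hc <;> simp [h', hc, hxxx, hxxy]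
    · rw [ih h3, zero_mul]

end Relations

/-! ### Matrix representations of the path algebra -/

section Representation

variable {K : Type u} [Field K] {R : Type*} [Ring R] [Algebra K R]

/-- The linear map sending a path from `i` to `j` to the matrix whose only entry is the word of
the path, at `(i, j)`. -/
noncomputable def pathMatrixLin (K : Type u) [Field K] {R : Type*} [Ring R] [Algebra K R]
    (x y : R) : PathAlgebra K Gam →ₗ[K] Matrix Gam Gam R :=
  (PathAlgebra.pathBasis K Gam).constr K fun p => Matrix.single p.1 p.2.1 (pathWord x y p.2.2)

lemma pathMatrixLin_ofPath (x y : R) {i j : Gam} (p : Quiver.Path i j) :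
    pathMatrixLin K x y (PathAlgebra.ofPath ⟨i, j, p⟩) = Matrix.single i j (pathWord x y p) := by
  rw [← PathAlgebra.pathBasis_apply, pathMatrixLin, Module.Basis.constr_basis]

lemma pathMatrixLin_mul (x y : R) (f g : PathAlgebra K Gam) :
    pathMatrixLin K x y (f * g) = pathMatrixLin K x y f * pathMatrixLin K x y g := by
  have key : (PathAlgebra.mulBilin K Gam).compr₂ (pathMatrixLin K x y) =
      (LinearMap.mul K (Matrix Gam Gam R)).compl₁₂ (pathMatrixLin K x y)
        (pathMatrixLin K x y) := by
    refine (PathAlgebra.pathBasis K Gam).ext fun p => (PathAlgebra.pathBasis K Gam).ext fun q => ?_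
    obtain ⟨i, j, p⟩ := p
    obtain ⟨k, l, q⟩ := q
    simp only [LinearMap.compr₂_apply, LinearMap.compl₁₂_apply, LinearMap.mul_apply',
      ← PathAlgebra.mul_def, PathAlgebra.pathBasis_apply]
    by_cases h : k = j
    · subst h
      rw [PathAlgebra.ofPath_mul_comp, pathMatrixLin_ofPath, pathMatrixLin_ofPath,
        pathMatrixLin_ofPath, Matrix.single_mul_single_same, pathWord_comp]
    · rw [PathAlgebra.ofPath_mul_of_ne _ _ h, pathMatrixLin_ofPath, pathMatrixLin_ofPath,
        Matrix.single_mul_single_of_ne _ _ _ _ (Ne.symm h), map_zero]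
  exact congrArg (fun t => t f g) key

lemma pathMatrixLin_one (x y : R) : pathMatrixLin K x y 1 = 1 := by
  rw [PathAlgebra.one_def, map_sum]
  simp only [pathMatrixLin_ofPath, pathWord]
  exact Matrix.sum_single_one

/-- The representation of the path algebra by matrices over `R` in which `a i` and `b i` act by
`x` and `y` from vertex `i` to vertex `i + 1`. -/
noncomputable def pathMatrix (K : Type u) [Field K] {R : Type*} [Ring R] [Algebra K R]
    (x y : R) : PathAlgebra K Gam →+* Matrix Gam Gam R where
  toFun := pathMatrixLin K x y
  map_one' := pathMatrixLin_one x y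
  map_mul' := pathMatrixLin_mul x y
  map_zero' := map_zero _
  map_add' := map_add _

/-- The matrix of the cyclic shift `i ↦ i + 1` with all nonzero entries equal to `z`. -/
def shiftMatrix (z : R) : Matrix Gam Gam R := ∑ i : Gam, Matrix.single i (i + 1) z

lemma pathMatrix_elemX (x y : R) : pathMatrix K x y (elemX K) = shiftMatrix x := by
  change pathMatrixLin K x y _ = _
  simp only [elemX, ofArrow, map_sum, pathMatrixLin_ofPath, shiftMatrix]
  simp [Quiver.Hom.toPath, pathWord, arrowValue]

lemma pathMatrix_elemY (x y : R) : pathMatrix K x y (elemY K) = shiftMatrix y := by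
  change pathMatrixLin K x y _ = _
  simp only [elemY, ofArrow, map_sum, pathMatrixLin_ofPath, shiftMatrix]
  simp [Quiver.Hom.toPath, pathWord, arrowValue]

lemma shiftMatrix_mul_apply (z : R) (M : Matrix Gam Gam R) (i j : Gam) :
    (shiftMatrix z * M) i j = z * M (i + 1) j := by
  rw [shiftMatrix, Finset.sum_mul, Matrix.sum_apply, Finset.sum_eq_single i]
  · simp
  · intro k _ hk
    simp [hk.symm]
  · simp

lemma shiftMatrix_mul_shiftMatrix_apply (z w : R) (i j : Gam) :
    (shiftMatrix z * shiftMatrix w) i j = z * w * (if i + 1 + 1 = j then 1 else 0) := by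
  have h : ∀ i j : Gam, shiftMatrix w i j = w * (if i + 1 = j then 1 else 0) := fun i j => by
    have := shiftMatrix_mul_apply w (1 : Matrix Gam Gam R) i j
    rwa [mul_one, Matrix.one_apply] at this
  rw [shiftMatrix_mul_apply, h, mul_assoc]

/-- If `x` and `y` satisfy the defining relations, the representation factors over the quotient
algebra. -/
noncomputable def quotMatrix {x y : R} (hxy : x * y = 0) (hyx : y * x = 0)
    (h : x * x + y * y = 0) : AlgA K 0 →+* Matrix Gam Gam R :=
  (idealI K 0).ringCon.lift (pathMatrix K x y) <| by
    have hle : idealI K 0 ≤ TwoSidedIdeal.ker (pathMatrix K x y) := by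
      rw [idealI, TwoSidedIdeal.span_le]
      rintro z (rfl | rfl | rfl) <;> rw [SetLike.mem_coe, TwoSidedIdeal.mem_ker] <;>
        simp only [map_mul, map_add, map_pow, pathMatrix_elemX, pathMatrix_elemY]
      · ext i j
        simp [shiftMatrix_mul_shiftMatrix_apply, hxy]
      · ext i j
        rw [mul_zero, zero_add, pow_two, pow_two, Matrix.add_apply,
          shiftMatrix_mul_shiftMatrix_apply, shiftMatrix_mul_shiftMatrix_apply, ← add_mul, h,
          zero_mul, Matrix.zero_apply]
      · ext i j
        simp [shiftMatrix_mul_shiftMatrix_apply, hyx]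
    intro f g hfg
    have := hle ((TwoSidedIdeal.rel_iff _ f g).mp hfg)
    rwa [TwoSidedIdeal.mem_ker, map_sub, sub_eq_zero] at this

end Representation

/-! ### Free left modules over `K⟨x, y⟩ / (xy, x² + y², yx)` -/

/-- Coordinates exhibiting a ring `A` as a left module over `⟨X, Y ∣ XY, X² + Y², YX⟩` that is
free on `E`: each `a : A` is uniquely `ι α + X ι β + Y ι γ + X² ι δ`, and left multiplication by
`X` and `Y` maps the coordinates `(α, β, γ, δ)` to `(0, α, 0, β)` and `(0, 0, α, -γ)`. -/
structure LeftCoords (E : Type*) {A : Type*} [AddCommGroup E] [Ring A] (X Y : A) where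
  ι : E →+ A
  α : A →+ E
  β : A →+ E
  γ : A →+ E
  δ : A →+ E
  decomp : ∀ a, a = ι (α a) + X * ι (β a) + Y * ι (γ a) + X * (X * ι (δ a))
  α_ι : ∀ e, α (ι e) = e
  β_ι : ∀ e, β (ι e) = 0
  γ_ι : ∀ e, γ (ι e) = 0
  δ_ι : ∀ e, δ (ι e) = 0
  α_X : ∀ a, α (X * a) = 0
  β_X : ∀ a, β (X * a) = α a
  γ_X : ∀ a, γ (X * a) = 0
  δ_X : ∀ a, δ (X * a) = β a
  α_Y : ∀ a, α (Y * a) = 0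
  β_Y : ∀ a, β (Y * a) = 0
  γ_Y : ∀ a, γ (Y * a) = α a
  δ_Y : ∀ a, δ (Y * a) = -γ a

namespace LeftCoords

variable {E A : Type*} [AddCommGroup E] [Ring A] {X Y : A}

lemma ext (c : LeftCoords E X Y) {a b : A} (hα : c.α a = c.α b) (hβ : c.β a = c.β b)
    (hγ : c.γ a = c.γ b) (hδ : c.δ a = c.δ b) : a = b := by
  rw [c.decomp a, c.decomp b, hα, hβ, hγ, hδ]

/-- Exchanging `X` and `Y` is a symmetry, up to the sign in `Y² = -X²`. -/
def swap (c : LeftCoords E X Y) : LeftCoords E Y X where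
  ι := c.ι
  α := c.α
  β := c.γ
  γ := c.β
  δ := -c.δ
  decomp a := by
    apply c.ext <;>
      simp [c.α_ι, c.β_ι, c.γ_ι, c.δ_ι, c.α_X, c.β_X, c.γ_X, c.δ_X, c.α_Y, c.β_Y, c.γ_Y, c.δ_Y]
  α_ι := c.α_ι
  β_ι := c.γ_ι
  γ_ι := c.β_ι
  δ_ι e := by simp [c.δ_ι]
  α_X := c.α_Y
  β_X := c.γ_Y
  γ_X := c.β_Y
  δ_X a := by simp [c.δ_Y]
  α_Y := c.α_X
  β_Y := c.γ_X
  γ_Y := c.β_X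
  δ_Y a := by simp [c.δ_X]

lemma X_mul_Y_mul (c : LeftCoords E X Y) (a : A) : X * (Y * a) = 0 := by
  apply c.ext <;> simp [c.α_X, c.β_X, c.γ_X, c.δ_X, c.α_Y, c.β_Y]

lemma Y_mul_X_mul (c : LeftCoords E X Y) (a : A) : Y * (X * a) = 0 := c.swap.X_mul_Y_mul a

lemma X_mul_X_mul_add_Y_mul_Y_mul (c : LeftCoords E X Y) (a : A) :
    X * (X * a) + Y * (Y * a) = 0 := by
  apply c.ext <;> simp [c.α_X, c.β_X, c.γ_X, c.δ_X, c.α_Y, c.β_Y, c.γ_Y, c.δ_Y]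

lemma exists_eq_of_α_eq_zero (c : LeftCoords E X Y) {a : A} (ha : c.α a = 0) :
    ∃ u v, a = X * u + Y * v := by
  refine ⟨c.ι (c.β a) + X * c.ι (c.δ a), c.ι (c.γ a), ?_⟩
  conv_lhs => rw [c.decomp a, ha, map_zero]
  noncomm_ring

end LeftCoords

/-! ### The bidiagonal complex -/

section Bidiagonal

variable {E A : Type*} [AddCommGroup E] [Ring A]

/-- Left multiplication by the matrix with `m` rows that has `U` on its diagonal, `V` right of it
and zeros elsewhere, as a homomorphism of right modules. -/
def bidiag (U V : A) (m : ℕ) : (Fin (m + 1) → A) →ₗ[Aᵐᵒᵖ] (Fin m → A) where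
  toFun v k := U * v k.castSucc + V * v k.succ
  map_add' v w := by
    ext k
    simp only [Pi.add_apply]
    noncomm_ring
  map_smul' r v := by
    ext k
    simp [mul_assoc]

lemma bidiag_apply (U V : A) (m : ℕ) (v : Fin (m + 1) → A) (k : Fin m) :
    bidiag U V m v k = U * v k.castSucc + V * v k.succ := rfl

variable {X Y : A}

/-- The bidiagonal matrices with the roles of `X` and `Y` alternating form an exact complex. In
coordinates, `v` lies in the kernel iff `α (v k) = 0` for all `k` and `β (v k) = γ (v (k + 1))`
for neighbouring `k`. -/
lemma LeftCoords.exact_bidiag (c : LeftCoords E X Y) (m : ℕ) :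
    Function.Exact (bidiag Y X (m + 2)) (bidiag X Y (m + 1)) := by
  intro v
  constructor
  · intro hv
    have hk (k : Fin (m + 1)) : X * v k.castSucc + Y * v k.succ = 0 := congrFun hv k
    have h1 (k : Fin (m + 1)) : c.α (v k.castSucc) = 0 := by
      simpa [c.β_X, c.β_Y] using congrArg c.β (hk k)
    have h2 (k : Fin (m + 1)) : c.α (v k.succ) = 0 := by
      simpa [c.γ_X, c.γ_Y] using congrArg c.γ (hk k)
    have h3 (k : Fin (m + 1)) : c.β (v k.castSucc) = c.γ (v k.succ) := by
      have := congrArg c.δ (hk k)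
      rwa [map_add, c.δ_X, c.δ_Y, map_zero, add_neg_eq_zero] at this
    have h0 (k : Fin (m + 2)) : c.α (v k) = 0 := by
      induction k using Fin.cases with
      | zero => exact h1 0
      | succ k => exact h2 k
    -- the coordinates `α` and `β` of a preimage `w`; its coordinates `γ` and `δ` may be `0`
    let p : Fin (m + 3) → E := Fin.cons (c.γ (v 0)) fun k => c.β (v k)
    let q : Fin (m + 3) → E := Fin.cons 0 fun k => c.δ (v k)
    have hp (k : Fin (m + 2)) : p k.castSucc = c.γ (v k) := by
      induction k using Fin.cases with
      | zero => rfl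
      | succ k =>
        rw [← h3 k]
        rfl
    have hp' (k : Fin (m + 2)) : p k.succ = c.β (v k) := rfl
    have hq' (k : Fin (m + 2)) : q k.succ = c.δ (v k) := rfl
    refine ⟨fun k => c.ι (p k) + X * c.ι (q k), ?_⟩
    funext k
    rw [bidiag_apply]
    apply c.ext <;>
      simp [c.α_ι, c.β_ι, c.γ_ι, c.α_X, c.β_X, c.γ_X, c.δ_X, c.α_Y, c.β_Y, c.γ_Y, c.δ_Y,
        h0, hp, hp', hq']
  · rintro ⟨w, rfl⟩
    funext k
    rw [bidiag_apply, bidiag_apply, bidiag_apply, mul_add, mul_add, c.X_mul_Y_mul,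
      c.Y_mul_X_mul, zero_add, add_zero, Fin.succ_castSucc, c.X_mul_X_mul_add_Y_mul_Y_mul]
    rfl

/-- The image of `(X, Y)` is the right ideal of elements without constant term. -/
lemma LeftCoords.mem_range_bidiag_one (c : LeftCoords E X Y) (v : Fin 1 → A) :
    v ∈ Set.range (bidiag X Y 1) ↔ c.α (v 0) = 0 := by
  constructor
  · rintro ⟨w, rfl⟩
    simp [bidiag_apply, c.α_X, c.α_Y]
  · intro hv
    obtain ⟨a, b, h⟩ := c.exists_eq_of_α_eq_zero hv
    refine ⟨![a, b], ?_⟩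
    funext k
    rw [Subsingleton.elim k 0, h]
    rfl

end Bidiagonal

/-! ### Injectivity from a nondegenerate form -/

/-- A module `M` over a `K`-algebra `B` is injective if some linear form `φ` on `M` identifies `M`
with the dual of `B` via `m ↦ φ (· • m)`: a linear form on `B` extending `φ ∘ g` provides the value
at `1` of an extension of a homomorphism `g` from a left ideal to `M`. -/
lemma Module.Injective.of_linearForm {K : Type*} {B : Type*} {M : Type*} [Field K] [Ring B]
    [Algebra K B] [AddCommGroup M] [Module K M] [Module B M] [IsScalarTower K B M]
    (φ : M →ₗ[K] K) (hφ : ∀ m, (∀ b : B, φ (b • m) = 0) → m = 0)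
    (hrep : ∀ ψ : B →ₗ[K] K, ∃ m, ∀ b, ψ b = φ (b • m)) : Module.Injective B M := by
  refine Module.Baer.injective fun I g => ?_
  obtain ⟨ψ, hψ⟩ := (φ ∘ₗ g.restrictScalars K).exists_extend (p := I.restrictScalars K)
  obtain ⟨m, hm⟩ := hrep ψ
  refine ⟨LinearMap.toSpanSingleton B M m, fun x hx => ?_⟩
  rw [LinearMap.toSpanSingleton_apply, ← sub_eq_zero]
  refine hφ _ fun b => ?_
  have h : ψ (b * x) = φ (g ⟨b * x, I.mul_mem_left b hx⟩) :=
    congrArg (fun t => t ⟨b * x, I.mul_mem_left b hx⟩) hψ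
  have hg : g ⟨b * x, I.mul_mem_left b hx⟩ = b • g ⟨x, hx⟩ := by
    rw [← map_smul]
    rfl
  rw [smul_sub, map_sub, ← mul_smul, ← hm, h, hg, sub_self]

/-- A finite-dimensional algebra with a nondegenerate associative bilinear form `φ (a * b)` is
self-injective. -/
lemma IsSelfInjective.of_linearForm {K : Type*} {A : Type u} [Field K] [Ring A] [Algebra K A]
    [FiniteDimensional K A] (φ : A →ₗ[K] K) (hφ : ∀ a, (∀ b, φ (b * a) = 0) → a = 0) :
    IsSelfInjective A := by
  -- `L a = φ (· * a)`
  let L : A →ₗ[K] A →ₗ[K] K := (LinearMap.mul K A).flip.compr₂ φ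
  have hL (a b : A) : L a b = φ (b * a) := rfl
  have hinj : Function.Injective L := (injective_iff_map_eq_zero L).mpr fun a ha =>
    hφ a fun b => by rw [← hL, ha, LinearMap.zero_apply]
  have hsurj : Function.Surjective L :=
    (LinearMap.injective_iff_surjective_of_finrank_eq_finrank
      (Subspace.dual_finrank_eq (K := K) (V := A)).symm).mp hinj
  have hφ' (b : A) (hb : ∀ a, φ (b * a) = 0) : b = 0 := by
    rw [← Module.forall_dual_apply_eq_zero_iff K]
    intro ψ
    obtain ⟨a, rfl⟩ := hsurj ψ
    exact hb a
  have hinj' : Function.Injective L.flip := (injective_iff_map_eq_zero L.flip).mpr fun b hb =>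
    hφ' b fun a => by rw [← hL, ← LinearMap.flip_apply, hb, LinearMap.zero_apply]
  have hsurj' : Function.Surjective L.flip :=
    (LinearMap.injective_iff_surjective_of_finrank_eq_finrank
      (Subspace.dual_finrank_eq (K := K) (V := A)).symm).mp hinj'
  constructor
  · refine Module.Injective.of_linearForm φ hφ fun ψ => ?_
    obtain ⟨a, rfl⟩ := hsurj ψ
    exact ⟨a, fun b => rfl⟩
  · refine Module.Injective.of_linearForm (K := K) φ
      (fun b hb => hφ' b fun a => hb (MulOpposite.op a)) fun ψ => ?_
    obtain ⟨b, hb⟩ := hsurj' (ψ ∘ₗ (MulOpposite.opLinearEquiv K).toLinearMap)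
    exact ⟨b, fun a => (congrArg (fun t => t a.unop) hb).symm⟩

/-! ### Gradings -/

/-- A family of additive submonoids is an internal direct sum decomposition if it spans and has
projections. -/
lemma DirectSum.isInternal_of_projections {ι M σ : Type*} [DecidableEq ι] [AddCommMonoid M]
    [SetLike σ M] [AddSubmonoidClass σ M] (D : ι → σ) (π : ι → M →+ M)
    (hπ : ∀ i, ∀ m ∈ D i, π i m = m) (hπ' : ∀ i j, i ≠ j → ∀ m ∈ D j, π i m = 0)
    (hD : ∀ m, m ∈ AddSubmonoid.closure {z | ∃ i, z ∈ D i}) : DirectSum.IsInternal D := by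
  constructor
  · have key (i : ι) (f : DirectSum ι fun i => D i) :
        π i (DirectSum.coeAddMonoidHom D f) = f i := by
      induction f using DirectSum.induction_on with
      | zero => simp
      | of j m =>
        rw [DirectSum.coeAddMonoidHom_of]
        by_cases h : i = j
        · subst h
          rw [hπ i _ m.2, DirectSum.of_eq_same]
        · rw [hπ' i j h _ m.2, DirectSum.of_eq_of_ne _ _ _ h, ZeroMemClass.coe_zero]
      | add f g hf hg =>
        rw [map_add, map_add, hf, hg, DirectSum.add_apply, AddMemClass.coe_add]
    intro f g hfg
    ext i
    rw [← key i f, hfg, key i g]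
  · intro m
    rw [← AddMonoidHom.mem_mrange]
    refine AddSubmonoid.closure_le.mpr ?_ (hD m)
    rintro z ⟨i, hz⟩
    exact ⟨DirectSum.of (fun i => D i) i ⟨z, hz⟩, DirectSum.coeAddMonoidHom_of ..⟩

section Shift

variable {K A : Type*} [Field K] [Ring A] [Algebra K A] (𝒜 : ℕ → Submodule K A)

/-- The part of degree `i` of the graded module `A(-n)`, that is, of `A` generated in degree
`n`. -/
def shiftPart (n i : ℕ) : AddSubgroup A :=
  if n ≤ i then (𝒜 (i - n)).toAddSubgroup else ⊥

lemma mem_shiftPart_add {n j : ℕ} {a : A} : a ∈ shiftPart 𝒜 n (n + j) ↔ a ∈ 𝒜 j := by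
  simp [shiftPart]

lemma mem_shiftPart_self {n : ℕ} {a : A} : a ∈ shiftPart 𝒜 n n ↔ a ∈ 𝒜 0 :=
  mem_shiftPart_add 𝒜 (j := 0)

lemma mem_shiftPart_of_lt {n i : ℕ} (h : i < n) {a : A} : a ∈ shiftPart 𝒜 n i ↔ a = 0 := by
  rw [shiftPart, if_neg (by omega), AddSubgroup.mem_bot]

/-- The part of degree `i` of the graded free right module `A(-n) ^ m`. -/
def freePart (m n i : ℕ) : AddSubgroup (Fin m → A) :=
  AddSubgroup.pi Set.univ fun _ => shiftPart 𝒜 n i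

lemma mem_freePart {m n i : ℕ} {v : Fin m → A} :
    v ∈ freePart 𝒜 m n i ↔ ∀ k, v k ∈ shiftPart 𝒜 n i := by
  simp [freePart, AddSubgroup.mem_pi]

variable [GradedAlgebra 𝒜]

lemma mul_mem_shiftPart {n i j : ℕ} {a z : A} (ha : a ∈ shiftPart 𝒜 n i) (hz : z ∈ 𝒜 j) :
    a * z ∈ shiftPart 𝒜 n (i + j) := by
  rcases le_or_gt n i with h | h
  · obtain ⟨l, rfl⟩ := Nat.exists_eq_add_of_le h
    rw [mem_shiftPart_add] at ha
    rw [add_assoc, mem_shiftPart_add]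
    exact SetLike.mul_mem_graded ha hz
  · rw [mem_shiftPart_of_lt 𝒜 h] at ha
    rw [ha, zero_mul]
    exact zero_mem _

/-- Left multiplication by an element of degree `1` is homogeneous from `A(-n-1)` to `A(-n)`. -/
lemma mul_mem_shiftPart_of_mem_one {n i : ℕ} {a z : A} (ha : a ∈ shiftPart 𝒜 (n + 1) i)
    (hz : z ∈ 𝒜 1) : z * a ∈ shiftPart 𝒜 n i := by
  rcases le_or_gt (n + 1) i with h | h
  · obtain ⟨l, rfl⟩ := Nat.exists_eq_add_of_le h
    rw [mem_shiftPart_add] at ha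
    rw [add_assoc, mem_shiftPart_add]
    exact SetLike.mul_mem_graded hz ha
  · rw [mem_shiftPart_of_lt 𝒜 h] at ha
    rw [ha, mul_zero]
    exact zero_mem _

lemma smul_mem_freePart {m n i j : ℕ} {v : Fin m → A} {z : A} (hv : v ∈ freePart 𝒜 m n i)
    (hz : z ∈ 𝒜 j) : MulOpposite.op z • v ∈ freePart 𝒜 m n (i + j) := by
  rw [mem_freePart] at hv ⊢
  exact fun k => mul_mem_shiftPart 𝒜 (hv k) hz

lemma bidiag_mem_freePart {m n i : ℕ} {U V : A} (hU : U ∈ 𝒜 1) (hV : V ∈ 𝒜 1)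
    {v : Fin (m + 1) → A} (hv : v ∈ freePart 𝒜 (m + 1) (n + 1) i) :
    bidiag U V m v ∈ freePart 𝒜 m n i := by
  rw [mem_freePart] at hv ⊢
  exact fun k => add_mem (mul_mem_shiftPart_of_mem_one 𝒜 (hv _) hU)
    (mul_mem_shiftPart_of_mem_one 𝒜 (hv _) hV)

lemma isInternal_freePart (m n : ℕ) : DirectSum.IsInternal (freePart 𝒜 m n) := by
  -- the projection to degree `i` of `A(-n)`
  let p (i : ℕ) : A →+ A := if n ≤ i then GradedRing.proj 𝒜 (i - n) else 0
  have hp (i : ℕ) (a : A) (ha : a ∈ shiftPart 𝒜 n i) : p i a = a := by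
    rcases le_or_gt n i with h | h
    · obtain ⟨l, rfl⟩ := Nat.exists_eq_add_of_le h
      rw [mem_shiftPart_add] at ha
      simp [p, GradedRing.proj_apply, DirectSum.decompose_of_mem_same 𝒜 ha]
    · rw [mem_shiftPart_of_lt 𝒜 h] at ha
      rw [ha, map_zero]
  have hp' (i j : ℕ) (hij : i ≠ j) (a : A) (ha : a ∈ shiftPart 𝒜 n j) : p i a = 0 := by
    rcases le_or_gt n j with h | h
    · obtain ⟨l, rfl⟩ := Nat.exists_eq_add_of_le h
      rw [mem_shiftPart_add] at ha
      by_cases hi : n ≤ i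
      · simp only [p, if_pos hi, GradedRing.proj_apply]
        exact DirectSum.decompose_of_mem_ne 𝒜 ha (by omega)
      · simp [p, hi]
    · rw [mem_shiftPart_of_lt 𝒜 h] at ha
      rw [ha, map_zero]
  refine DirectSum.isInternal_of_projections _
    (fun i => (p i).compLeft (Fin m)) ?_ ?_ ?_
  · intro i v hv
    rw [mem_freePart] at hv
    funext k
    exact hp i _ (hv k)
  · intro i j hij v hv
    rw [mem_freePart] at hv
    funext k
    exact hp' i j hij _ (hv k)
  · intro v
    rw [← Finset.univ_sum_single v]
    refine sum_mem fun k _ => ?_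
    induction v k using DirectSum.Decomposition.inductionOn 𝒜 with
    | zero => simp
    | @homogeneous l a =>
      refine AddSubmonoid.subset_closure ⟨n + l, ?_⟩
      rw [mem_freePart]
      intro k'
      rw [mem_shiftPart_add]
      by_cases h : k' = k
      · subst h
        simp
      · simp [h]
    | add a b ha hb =>
      rw [Pi.single_add]
      exact add_mem ha hb

lemma span_freePart_self (m n : ℕ) :
    Submodule.span Aᵐᵒᵖ (freePart 𝒜 m n n : Set (Fin m → A)) = ⊤ := by
  rw [eq_top_iff]
  rintro v -
  rw [← Finset.univ_sum_single v]
  refine sum_mem fun k _ => ?_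
  have h : Pi.single k (v k) = MulOpposite.op (v k) • (Pi.single k 1 : Fin m → A) := by
    rw [← Pi.single_smul, op_smul_eq_mul, one_mul]
  rw [h]
  refine Submodule.smul_mem _ _ (Submodule.subset_span ?_)
  rw [SetLike.mem_coe, mem_freePart]
  intro k'
  rw [mem_shiftPart_self]
  by_cases h : k' = k
  · subst h
    simpa using SetLike.one_mem_graded 𝒜
  · simp [h]

end Shift

/-! ### The linear resolution -/

section Resolution

variable {K A : Type u} {E : Type*} [Field K] [Ring A] [Algebra K A] [AddCommGroup E]
  (𝒜 : ℕ → Submodule K A) [GradedAlgebra 𝒜] {X Y : A}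

lemma projective_op_pi (A : Type*) [Ring A] (m : ℕ) : Module.Projective Aᵐᵒᵖ (Fin m → A) :=
  Module.Projective.of_equiv <|
    (Finsupp.linearEquivFunOnFinite Aᵐᵒᵖ Aᵐᵒᵖ (Fin m)).trans
      (LinearEquiv.piCongrRight fun _ => (MulOpposite.opLinearEquiv Aᵐᵒᵖ).symm)

/-- The linear resolution of `A / A₊` by the modules `A(-n) ^ (n + 1)`, whose differentials are the
bidiagonal matrices in `X` and `Y`, with `X` and `Y` exchanged in every second degree. -/
noncomputable def LeftCoords.linearResolution (c : LeftCoords E X Y) (hX : X ∈ 𝒜 1) (hY : Y ∈ 𝒜 1)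
    (h : ∀ a, a ∈ positivePart 𝒜 ↔ c.α a = 0) : LinearResolution 𝒜 (A ⧸ positivePart 𝒜) where
  P n := Fin (n + 1) → A
  deg n i := freePart 𝒜 (n + 1) n i
  isInternal n := isInternal_freePart 𝒜 (n + 1) n
  smul_mem _ _ _ _ _ hm hz := smul_mem_freePart 𝒜 hm hz
  projective n := projective_op_pi A (n + 1)
  generated n := span_freePart_self 𝒜 (n + 1) n
  d n := if Even n then bidiag X Y (n + 1) else bidiag Y X (n + 1)
  d_mem n i m hm := by
    split_ifs
    · exact bidiag_mem_freePart 𝒜 hX hY hm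
    · exact bidiag_mem_freePart 𝒜 hY hX hm
  ε := (positivePart 𝒜).mkQ ∘ₗ LinearMap.proj 0
  ε_eq_zero i m hi hm := by
    rw [LinearMap.comp_apply, Submodule.mkQ_apply, Submodule.Quotient.mk_eq_zero]
    refine Submodule.subset_span ⟨i, by omega, ?_⟩
    have := (mem_freePart 𝒜).mp hm 0
    rwa [← zero_add i, mem_shiftPart_add] at this
  surjective := (Submodule.mkQ_surjective _).comp (LinearMap.proj_surjective 0)
  exact_zero v := by
    rw [if_pos Even.zero, c.mem_range_bidiag_one, ← h, LinearMap.comp_apply, Submodule.mkQ_apply,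
      Submodule.Quotient.mk_eq_zero]
    rfl
  exact_succ n := by
    by_cases hn : Even n
    · rw [if_pos hn, if_neg (by simpa [Nat.even_add_one] using hn)]
      exact c.exact_bidiag n
    · rw [if_neg hn, if_pos (by simpa [Nat.even_add_one] using hn)]
      exact c.swap.exact_bidiag n

end Resolution

/-! ### Coordinates on `A₀` -/

section Coordinates

variable (K : Type u) [Field K]

/-- The class of the trivial path at `j` in `A₀`. -/
noncomputable def idem (j : Gam) : AlgA K 0 :=
  projA K 0 (PathAlgebra.ofPath ⟨j, j, Quiver.Path.nil⟩)

/-- The class of `x` in `A₀`. -/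
noncomputable def genX : AlgA K 0 := projA K 0 (elemX K)

/-- The class of `y` in `A₀`. -/
noncomputable def genY : AlgA K 0 := projA K 0 (elemY K)

lemma projA_mul (f g : PathAlgebra K Gam) : projA K 0 (f * g) = projA K 0 f * projA K 0 g := rfl

lemma projA_surjective : Function.Surjective (projA K 0) := fun a => by
  obtain ⟨f, rfl⟩ := RingCon.mk'_surjective (c := (idealI K 0).ringCon) a
  exact ⟨f, rfl⟩

lemma projA_eq_zero {f : PathAlgebra K Gam} (hf : f ∈ idealI K 0) : projA K 0 f = 0 :=
  (RingCon.eq _).mpr ((TwoSidedIdeal.mem_iff _ _).mp hf)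

lemma genX_mul_genY : genX K * genY K = 0 := by
  rw [genX, genY, ← projA_mul]
  exact projA_eq_zero K (TwoSidedIdeal.subset_span (by simp))

lemma genY_mul_genX : genY K * genX K = 0 := by
  rw [genX, genY, ← projA_mul]
  exact projA_eq_zero K (TwoSidedIdeal.subset_span (by simp))

lemma genX_mul_genX_add : genX K * genX K + genY K * genY K = 0 := by
  rw [genX, genY, ← projA_mul, ← projA_mul, ← map_add, ← pow_two, ← pow_two]
  exact projA_eq_zero K (TwoSidedIdeal.subset_span (by simp))

variable {K} in
lemma ofPath_mul_elemX {i j : Gam} (p : Quiver.Path i j) :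
    PathAlgebra.ofPath ⟨i, j, p⟩ * elemX K =
      PathAlgebra.ofPath ⟨i, j + 1, p.cons (GamArrow.a j)⟩ := by
  rw [elemX, Finset.mul_sum, Finset.sum_eq_single j]
  · exact PathAlgebra.ofPath_mul_comp _ _
  · intro k _ hk
    exact PathAlgebra.ofPath_mul_of_ne _ _ hk
  · simp

variable {K} in
lemma ofPath_mul_elemY {i j : Gam} (p : Quiver.Path i j) :
    PathAlgebra.ofPath ⟨i, j, p⟩ * elemY K =
      PathAlgebra.ofPath ⟨i, j + 1, p.cons (GamArrow.b j)⟩ := by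
  rw [elemY, Finset.mul_sum, Finset.sum_eq_single j]
  · exact PathAlgebra.ofPath_mul_comp _ _
  · intro k _ hk
    exact PathAlgebra.ofPath_mul_of_ne _ _ hk
  · simp

lemma idem_mul_genX (j : Gam) : idem K j * genX K = genX K * idem K (j + 1) := by
  rw [idem, idem, genX, ← projA_mul, ← projA_mul, ofPath_mul_elemX, elemX, Finset.sum_mul,
    Finset.sum_eq_single j]
  · rw [ofArrow, PathAlgebra.ofPath_mul_comp]
    rfl
  · intro k _ hk
    exact PathAlgebra.ofPath_mul_of_ne _ _ fun h => hk (add_right_cancel h).symm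
  · simp

lemma idem_mul_genY (j : Gam) : idem K j * genY K = genY K * idem K (j + 1) := by
  rw [idem, idem, genY, ← projA_mul, ← projA_mul, ofPath_mul_elemY, elemY, Finset.sum_mul,
    Finset.sum_eq_single j]
  · rw [ofArrow, PathAlgebra.ofPath_mul_comp]
    rfl
  · intro k _ hk
    exact PathAlgebra.ofPath_mul_of_ne _ _ fun h => hk (add_right_cancel h).symm
  · simp

lemma idem_mul_self (j : Gam) : idem K j * idem K j = idem K j := by
  rw [idem, ← projA_mul, PathAlgebra.ofPath_mul_comp]
  rfl

lemma idem_mul_of_ne {i j : Gam} (h : i ≠ j) : idem K i * idem K j = 0 := by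
  rw [idem, idem, ← projA_mul, PathAlgebra.ofPath_mul_of_ne _ _ h.symm, map_zero]

/-- Modulo the relations, a path ending at `j` is its word in `x` and `y` times `e_j`. -/
lemma projA_ofPath {i j : Gam} (p : Quiver.Path i j) :
    projA K 0 (PathAlgebra.ofPath ⟨i, j, p⟩) =
      pathWord (genX K) (genY K) p * idem K j := by
  induction p with
  | nil => rw [pathWord, one_mul, idem]
  | cons p c ih =>
    rcases c with _ | _
    · rw [← ofPath_mul_elemX, projA_mul, ih, ← genX, mul_assoc, idem_mul_genX, ← mul_assoc]
      rfl
    · rw [← ofPath_mul_elemY, projA_mul, ih, ← genY, mul_assoc, idem_mul_genY, ← mul_assoc]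
      rfl

/-- The matrix of left multiplication by `x` on `K⟨x, y⟩ / (xy, x² + y², yx)` in the basis
`1, x, y, x²`. -/
def matX : Matrix (Fin 4) (Fin 4) K := !![0, 0, 0, 0; 1, 0, 0, 0; 0, 0, 0, 0; 0, 1, 0, 0]

/-- The matrix of left multiplication by `y` on `K⟨x, y⟩ / (xy, x² + y², yx)` in the basis
`1, x, y, x²`. -/
def matY : Matrix (Fin 4) (Fin 4) K := !![0, 0, 0, 0; 0, 0, 0, 0; 1, 0, 0, 0; 0, 0, -1, 0]

lemma matX_mul_matY : matX K * matY K = 0 := by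
  ext i j
  fin_cases i <;> fin_cases j <;> simp [matX, matY]

lemma matY_mul_matX : matY K * matX K = 0 := by
  ext i j
  fin_cases i <;> fin_cases j <;> simp [matX, matY]

lemma matX_mul_matX_add : matX K * matX K + matY K * matY K = 0 := by
  ext i j
  fin_cases i <;> fin_cases j <;> simp [matX, matY]

/-- The representation of `A₀` by `4 × 4` matrices whose entries are the left multiplications of
`K⟨x, y⟩ / (xy, x² + y², yx)`. -/
noncomputable def rep : AlgA K 0 →+* Matrix Gam Gam (Matrix (Fin 4) (Fin 4) K) :=
  quotMatrix (matX_mul_matY K) (matY_mul_matX K) (matX_mul_matX_add K)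

lemma rep_projA (f : PathAlgebra K Gam) :
    rep K (projA K 0 f) = pathMatrix K (matX K) (matY K) f := rfl

lemma rep_smul (r : K) (a : AlgA K 0) : rep K (r • a) = r • rep K a := by
  obtain ⟨f, rfl⟩ := projA_surjective K a
  rw [← map_smul, rep_projA, rep_projA]
  exact map_smul (pathMatrixLin K (matX K) (matY K)) r f

/-- The coordinate of `A₀` at the `k`-th element `w` of `1, x, y, x²`: for each vertex `j`, the
coefficient of `w e_j`. -/
noncomputable def coord (k : Fin 4) : AlgA K 0 →ₗ[K] (Gam → K) where
  toFun a j := ∑ i, rep K a i j k 0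
  map_add' a b := by
    funext j
    simp [Finset.sum_add_distrib]
  map_smul' r a := by
    funext j
    simp [rep_smul, Finset.mul_sum]

lemma coord_apply (k : Fin 4) (a : AlgA K 0) (j : Gam) :
    coord K k a j = ∑ i, rep K a i j k 0 := rfl

lemma coord_eq_of_rep_eq_shiftMatrix {z : AlgA K 0} {M : Matrix (Fin 4) (Fin 4) K}
    (hz : rep K z = shiftMatrix M) (k : Fin 4) (a : AlgA K 0) :
    coord K k (z * a) = ∑ l, M k l • coord K l a := by
  funext j
  simp only [coord_apply, map_mul, hz, shiftMatrix_mul_apply, Finset.sum_apply,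
    Pi.smul_apply, smul_eq_mul]
  simp only [Matrix.mul_apply]
  rw [Finset.sum_comm]
  refine Finset.sum_congr rfl fun l _ => ?_
  rw [Finset.mul_sum]
  exact Equiv.sum_comp (Equiv.addRight (1 : Gam)) fun i => M k l * rep K a i j l 0

lemma coord_genX_mul (k : Fin 4) (a : AlgA K 0) :
    coord K k (genX K * a) = ∑ l, matX K k l • coord K l a :=
  coord_eq_of_rep_eq_shiftMatrix K (by rw [genX, rep_projA, pathMatrix_elemX]) k a

lemma coord_genY_mul (k : Fin 4) (a : AlgA K 0) :
    coord K k (genY K * a) = ∑ l, matY K k l • coord K l a :=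
  coord_eq_of_rep_eq_shiftMatrix K (by rw [genY, rep_projA, pathMatrix_elemY]) k a

/-- The embedding of `K ^ 4`, spanned by the idempotents `e_j`, in `A₀`. -/
noncomputable def diag : (Gam → K) →ₗ[K] AlgA K 0 :=
  Fintype.linearCombination K (idem K)

lemma diag_apply (e : Gam → K) : diag K e = ∑ j, e j • idem K j := rfl

lemma diag_single (j : Gam) : diag K (Pi.single j 1) = idem K j := by
  rw [diag, Fintype.linearCombination_apply_single, one_smul]

lemma coord_idem (k : Fin 4) (j : Gam) :
    coord K k (idem K j) = if k = 0 then Pi.single j 1 else 0 := by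
  have h : rep K (idem K j) = Matrix.single j j 1 := by
    rw [idem, rep_projA]
    exact pathMatrixLin_ofPath _ _ _
  funext l
  rw [coord_apply, h, Finset.sum_eq_single j]
  · by_cases hl : j = l
    · subst hl
      by_cases hk : k = 0 <;> simp [hk]
    · by_cases hk : k = 0 <;> simp [hk, hl, Ne.symm hl]
  · intro i _ hi
    simp [Matrix.single, Ne.symm hi]
  · simp

lemma coord_diag (k : Fin 4) (e : Gam → K) : coord K k (diag K e) = if k = 0 then e else 0 := by
  rw [diag_apply, map_sum]
  simp only [map_smul, coord_idem]
  by_cases hk : k = 0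
  · simp only [if_pos hk]
    funext l
    simp [Finset.sum_apply, Pi.single_apply]
  · simp [hk]

/-- The class of a path, by its length. -/
lemma projA_ofPath_cases {n : ℕ} {p : AllPaths Gam} (hp : p.2.2.length = n) :
    let z := projA K 0 (PathAlgebra.ofPath p)
    (n = 0 ∧ ∃ j, z = idem K j) ∨ (n = 1 ∧ ∃ j, z = genX K * idem K j ∨ z = genY K * idem K j) ∨
      (n = 2 ∧ ∃ j, z = genX K * (genX K * idem K j) ∨ z = -(genX K * (genX K * idem K j))) ∨
      z = 0 := by
  obtain ⟨i, j, p⟩ := p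
  simp only [projA_ofPath, ← mul_assoc]
  have h1 := genX_mul_genY K
  have h2 := genY_mul_genX K
  have h3 := genX_mul_genX_add K
  obtain rfl | rfl | rfl | hn : n = 0 ∨ n = 1 ∨ n = 2 ∨ 3 ≤ n := by omega
  · exact Or.inl ⟨rfl, j, by rw [pathWord_of_length_eq_zero p hp, one_mul]⟩
  · refine Or.inr (Or.inl ⟨rfl, j, ?_⟩)
    exact (pathWord_of_length_eq_one p hp).imp (congrArg (· * _)) (congrArg (· * _))
  · rcases pathWord_of_length_eq_two h1 h2 h3 p hp with h | h | h
    · exact Or.inr (Or.inr (Or.inl ⟨rfl, j, Or.inl (by rw [h])⟩))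
    · exact Or.inr (Or.inr (Or.inl ⟨rfl, j, Or.inr (by rw [h, neg_mul])⟩))
    · exact Or.inr (Or.inr (Or.inr (by rw [h, zero_mul])))
  · exact Or.inr (Or.inr (Or.inr (by
      rw [pathWord_of_three_le_length h1 h2 h3 p (hp ▸ hn), zero_mul])))

/-- The projection of `A₀` to the part of degree `n`. -/
noncomputable def partProj : ℕ → AlgA K 0 →ₗ[K] AlgA K 0
  | 0 => diag K ∘ₗ coord K 0
  | 1 => LinearMap.mulLeft K (genX K) ∘ₗ diag K ∘ₗ coord K 1 +
      LinearMap.mulLeft K (genY K) ∘ₗ diag K ∘ₗ coord K 2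
  | 2 => LinearMap.mulLeft K (genX K) ∘ₗ LinearMap.mulLeft K (genX K) ∘ₗ diag K ∘ₗ coord K 3
  | _ + 3 => 0

lemma partProj_ofPath (m : ℕ) {n : ℕ} {p : AllPaths Gam} (hp : p.2.2.length = n) :
    partProj K m (projA K 0 (PathAlgebra.ofPath p)) =
      if m = n then projA K 0 (PathAlgebra.ofPath p) else 0 := by
  obtain rfl | rfl | rfl | ⟨m, rfl⟩ : m = 0 ∨ m = 1 ∨ m = 2 ∨ ∃ l, m = l + 3 := by
    match m with
    | 0 => simp
    | 1 => simp
    | 2 => simp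
    | m + 3 => exact Or.inr (Or.inr (Or.inr ⟨m, rfl⟩))
  all_goals
    rcases projA_ofPath_cases K hp with
      ⟨rfl, j, h⟩ | ⟨rfl, j, h | h⟩ | ⟨rfl, j, h | h⟩ | h <;>
    rw [h] <;>
    simp [partProj, coord_genX_mul, coord_genY_mul, Fin.sum_univ_four, matX, matY, coord_idem,
      diag_single]

lemma partProj_of_mem (m n : ℕ) {a : AlgA K 0} (ha : a ∈ lengthPart K 0 n) :
    partProj K m a = if m = n then a else 0 := by
  induction ha using Submodule.span_induction with
  | mem z hz =>
    obtain ⟨p, hp, rfl⟩ := hz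
    exact partProj_ofPath K m hp
  | zero => simp
  | add a b _ _ ha hb => rw [map_add, ha, hb]; split_ifs <;> simp
  | smul r a _ ha => rw [map_smul, ha]; split_ifs <;> simp

lemma sum_partProj (a : AlgA K 0) : partProj K 0 a + partProj K 1 a + partProj K 2 a = a := by
  have key : (partProj K 0 + partProj K 1 + partProj K 2) ∘ₗ projA K 0 = projA K 0 := by
    refine (PathAlgebra.pathBasis K Gam).ext fun p => ?_
    simp only [LinearMap.comp_apply, LinearMap.add_apply, PathAlgebra.pathBasis_apply,
      partProj_ofPath K _ rfl]
    rcases projA_ofPath_cases K (p := p) rfl with ⟨h, -⟩ | ⟨h, -⟩ | ⟨h, -⟩ | h <;> simp [h]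
  obtain ⟨f, rfl⟩ := projA_surjective K a
  exact congrArg (fun t => t f) key

/-- `A₀` is free on `K ^ 4` as a left module over `K⟨x, y⟩ / (xy, x² + y², yx)`. -/
noncomputable def leftCoords : LeftCoords (Gam → K) (genX K) (genY K) where
  ι := (diag K).toAddMonoidHom
  α := (coord K 0).toAddMonoidHom
  β := (coord K 1).toAddMonoidHom
  γ := (coord K 2).toAddMonoidHom
  δ := (coord K 3).toAddMonoidHom
  decomp a := by
    conv_lhs => rw [← sum_partProj K a]
    simp [partProj, add_assoc]
  α_ι e := by simp [coord_diag]
  β_ι e := by simp [coord_diag]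
  γ_ι e := by simp [coord_diag]
  δ_ι e := by simp [coord_diag]
  α_X a := by simp [coord_genX_mul, Fin.sum_univ_four, matX]
  β_X a := by simp [coord_genX_mul, Fin.sum_univ_four, matX]
  γ_X a := by simp [coord_genX_mul, Fin.sum_univ_four, matX]
  δ_X a := by simp [coord_genX_mul, Fin.sum_univ_four, matX]
  α_Y a := by simp [coord_genY_mul, Fin.sum_univ_four, matY]
  β_Y a := by simp [coord_genY_mul, Fin.sum_univ_four, matY]
  γ_Y a := by simp [coord_genY_mul, Fin.sum_univ_four, matY]
  δ_Y a := by simp [coord_genY_mul, Fin.sum_univ_four, matY]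

end Coordinates

/-! ### The grading, the radical and the form -/

section Structure

variable (K : Type u) [Field K]

lemma idem_mem (j : Gam) : idem K j ∈ lengthPart K 0 0 := Submodule.subset_span ⟨_, rfl, rfl⟩

lemma diag_mem (e : Gam → K) : diag K e ∈ lengthPart K 0 0 := by
  rw [diag_apply]
  exact sum_mem fun j _ => Submodule.smul_mem _ _ (idem_mem K j)

lemma diag_one : diag K 1 = 1 := by
  rw [diag_apply]
  simp only [Pi.one_apply, one_smul, idem]
  rw [← map_sum, ← PathAlgebra.one_def]
  rfl

lemma one_mem_lengthPart : (1 : AlgA K 0) ∈ lengthPart K 0 0 :=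
  diag_one K ▸ diag_mem K 1

lemma mul_mem_lengthPart {m n : ℕ} {a b : AlgA K 0} (ha : a ∈ lengthPart K 0 m)
    (hb : b ∈ lengthPart K 0 n) : a * b ∈ lengthPart K 0 (m + n) := by
  have h := Submodule.mul_mem_mul ha hb
  rw [lengthPart, lengthPart, Submodule.span_mul_span] at h
  refine Submodule.span_le.mpr ?_ h
  rintro _ ⟨_, ⟨⟨i, j, p⟩, rfl, rfl⟩, _, ⟨⟨k, l, q⟩, rfl, rfl⟩, rfl⟩
  change projA K 0 (PathAlgebra.ofPath _ * PathAlgebra.ofPath _) ∈ lengthPart K 0 _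
  by_cases hkj : k = j
  · subst hkj
    rw [PathAlgebra.ofPath_mul_comp]
    exact Submodule.subset_span ⟨_, Quiver.Path.length_comp _ _, rfl⟩
  · rw [PathAlgebra.ofPath_mul_of_ne _ _ hkj, map_zero]
    exact zero_mem _

lemma genX_mem : genX K ∈ lengthPart K 0 1 := by
  rw [genX, elemX, map_sum]
  exact sum_mem fun i _ => Submodule.subset_span ⟨_, rfl, rfl⟩

lemma genY_mem : genY K ∈ lengthPart K 0 1 := by
  rw [genY, elemY, map_sum]
  exact sum_mem fun i _ => Submodule.subset_span ⟨_, rfl, rfl⟩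

lemma partProj_mem (n : ℕ) (a : AlgA K 0) : partProj K n a ∈ lengthPart K 0 n := by
  rcases n with _ | _ | _ | n
  · exact diag_mem K _
  · have hX := mul_mem_lengthPart K (genX_mem K) (diag_mem K (coord K 1 a))
    have hY := mul_mem_lengthPart K (genY_mem K) (diag_mem K (coord K 2 a))
    exact add_mem hX hY
  · have hX := mul_mem_lengthPart K (genX_mem K) (diag_mem K (coord K 3 a))
    have hXX := mul_mem_lengthPart K (genX_mem K) hX
    exact hXX
  · exact zero_mem _

lemma isInternal_lengthPart : DirectSum.IsInternal (lengthPart K 0) := by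
  refine DirectSum.isInternal_of_projections _ (fun n => (partProj K n).toAddMonoidHom) ?_ ?_ ?_
  · intro n a ha
    exact (partProj_of_mem K n n ha).trans (if_pos rfl)
  · intro m n h a ha
    exact (partProj_of_mem K m n ha).trans (if_neg h)
  · intro a
    rw [← sum_partProj K a]
    have h (n : ℕ) : partProj K n a ∈ AddSubmonoid.closure {z | ∃ n, z ∈ lengthPart K 0 n} :=
      AddSubmonoid.subset_closure ⟨n, partProj_mem K n a⟩
    exact add_mem (add_mem (h 0) (h 1)) (h 2)

/-- The grading of `A₀` by path length. -/
noncomputable instance lengthGrading : GradedAlgebra (lengthPart K 0) where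
  one_mem := one_mem_lengthPart K
  mul_mem _ _ _ _ ha hb := mul_mem_lengthPart K ha hb
  toDecomposition := (isInternal_lengthPart K).chooseDecomposition

lemma idem_mul_diag (i : Gam) (e : Gam → K) : idem K i * diag K e = e i • idem K i := by
  rw [diag_apply, Finset.mul_sum, Finset.sum_eq_single i]
  · rw [mul_smul_comm, idem_mul_self]
  · intro j _ hj
    rw [mul_smul_comm, idem_mul_of_ne K hj.symm, smul_zero]
  · simp

lemma diag_mul_diag (e f : Gam → K) : diag K e * diag K f = diag K (e * f) := by
  rw [diag_apply K e, diag_apply K (e * f), Finset.sum_mul]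
  refine Finset.sum_congr rfl fun i _ => ?_
  rw [smul_mul_assoc, idem_mul_diag, smul_smul, Pi.mul_apply]

lemma coord_zero_diag_mul (e : Gam → K) (a : AlgA K 0) :
    coord K 0 (diag K e * a) = e * coord K 0 a := by
  have hX (j : Gam) (z : AlgA K 0) : coord K 0 (idem K j * (genX K * z)) = 0 := by
    rw [← mul_assoc, idem_mul_genX, mul_assoc]
    exact (leftCoords K).α_X _
  have hY (j : Gam) (z : AlgA K 0) : coord K 0 (idem K j * (genY K * z)) = 0 := by
    rw [← mul_assoc, idem_mul_genY, mul_assoc]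
    exact (leftCoords K).α_Y _
  have h0 : diag K e * diag K (coord K 0 a) = diag K (e * coord K 0 a) := diag_mul_diag K _ _
  obtain ⟨u, v, h⟩ := (leftCoords K).exists_eq_of_α_eq_zero (a := a - diag K (coord K 0 a))
    (by
      change coord K 0 _ = 0
      simp [coord_diag])
  rw [sub_eq_iff_eq_add] at h
  conv_lhs => rw [h, mul_add, h0, map_add, coord_diag, if_pos rfl]
  rw [diag_apply, Finset.sum_mul, map_sum, add_eq_right]
  refine Finset.sum_eq_zero fun j _ => ?_
  rw [smul_mul_assoc, map_smul, mul_add, map_add, hX, hY, add_zero, smul_zero]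

lemma coord_zero_mul (a b : AlgA K 0) : coord K 0 (a * b) = coord K 0 a * coord K 0 b := by
  obtain ⟨u, v, h⟩ := (leftCoords K).exists_eq_of_α_eq_zero (a := a - diag K (coord K 0 a))
    (by
      change coord K 0 _ = 0
      simp [coord_diag])
  rw [sub_eq_iff_eq_add] at h
  have hX (z : AlgA K 0) : coord K 0 (genX K * z) = 0 := (leftCoords K).α_X _
  have hY (z : AlgA K 0) : coord K 0 (genY K * z) = 0 := (leftCoords K).α_Y _
  conv_lhs => rw [h]
  rw [add_mul, add_mul, mul_assoc, mul_assoc, map_add, map_add, hX, hY, coord_zero_diag_mul,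
    add_zero, zero_add]

lemma coord_zero_one : coord K 0 1 = 1 := by
  rw [← diag_one, coord_diag, if_pos rfl]

/-- The projection of `A₀` to its part of degree `0`, as a ring homomorphism to `K ^ 4`. -/
noncomputable def augmentation : AlgA K 0 →+* (Gam → K) where
  toFun := coord K 0
  map_one' := coord_zero_one K
  map_mul' := coord_zero_mul K
  map_zero' := map_zero _
  map_add' := map_add _

lemma augmentation_apply (a : AlgA K 0) : augmentation K a = coord K 0 a := rfl

lemma mem_positivePart {a : AlgA K 0} :
    a ∈ positivePart (lengthPart K 0) ↔ coord K 0 a = 0 := by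
  constructor
  · intro ha
    induction ha using Submodule.span_induction with
    | mem z hz =>
      obtain ⟨n, hn, hz⟩ := hz
      have h := partProj_of_mem K 0 n hz
      rw [if_neg (by omega)] at h
      have := congrArg (coord K 0) h
      simpa [partProj, coord_diag] using this
    | zero => exact map_zero _
    | add a b _ _ ha hb => rw [map_add, ha, hb, add_zero]
    | smul r a _ ha => rw [MulOpposite.smul_eq_mul_unop, coord_zero_mul, ha, zero_mul]
  · intro ha
    obtain ⟨u, v, h⟩ := (leftCoords K).exists_eq_of_α_eq_zero ha
    rw [h]
    exact add_mem
      (Submodule.smul_mem _ (MulOpposite.op u) (Submodule.subset_span ⟨1, le_rfl, genX_mem K⟩))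
      (Submodule.smul_mem _ (MulOpposite.op v) (Submodule.subset_span ⟨1, le_rfl, genY_mem K⟩))

/-- A product of two elements of `⨁_{n ≥ 1} A_n` lies in `A_2`: its coefficients in degree `1`
vanish. -/
lemma coord_mul_of_coord_zero {a b : AlgA K 0} (ha : coord K 0 a = 0) (hb : coord K 0 b = 0) :
    coord K 1 (a * b) = 0 ∧ coord K 2 (a * b) = 0 := by
  obtain ⟨u, v, rfl⟩ := (leftCoords K).exists_eq_of_α_eq_zero ha
  rw [add_mul, mul_assoc, mul_assoc]
  constructor <;>
    simp [coord_genX_mul, coord_genY_mul, Fin.sum_univ_four, matX, matY, coord_zero_mul, hb]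

/-- Writing `a = xu + yv`, one has `a³ = x(ua · a) + y(va · a)`, where the products in parentheses
have no part of degree below `2`. -/
lemma pow_three_eq_zero {a : AlgA K 0} (ha : coord K 0 a = 0) : a ^ 3 = 0 := by
  obtain ⟨u, v, h⟩ := (leftCoords K).exists_eq_of_α_eq_zero ha
  have h0 (w : AlgA K 0) : coord K 0 (w * a) = 0 := by rw [coord_zero_mul, ha, mul_zero]
  have hu := coord_mul_of_coord_zero K (h0 u) ha
  have hv := coord_mul_of_coord_zero K (h0 v) ha
  have h3 : a ^ 3 = genX K * (u * a * a) + genY K * (v * a * a) := by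
    calc a ^ 3 = (genX K * u + genY K * v) * a * a := by rw [← h]; noncomm_ring
      _ = _ := by noncomm_ring
  rw [h3]
  apply (leftCoords K).ext <;>
    simp [leftCoords, coord_genX_mul, coord_genY_mul, Fin.sum_univ_four, matX, matY, h0, hu, hv]

lemma mem_jacobson {a : AlgA K 0} : a ∈ Ring.jacobson (AlgA K 0) ↔ coord K 0 a = 0 := by
  constructor
  · intro ha
    have hs : Function.Surjective (augmentation K) := fun e =>
      ⟨diag K e, by rw [augmentation_apply, coord_diag, if_pos rfl]⟩
    have : RingHomSurjective (augmentation K) := ⟨hs⟩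
    have h := Ring.le_comap_jacobson (augmentation K) ha
    rwa [IsSemisimpleRing.jacobson_eq_bot, Ideal.mem_comap, Ideal.mem_bot] at h
  · intro ha
    rw [← Ideal.jacobson_bot, Ideal.mem_jacobson_iff]
    intro b
    -- `n = ba` is nilpotent, hence `1 + n` is invertible
    have hn : (b * a) ^ 3 = 0 := pow_three_eq_zero K (by rw [coord_zero_mul, ha, mul_zero])
    refine ⟨1 - b * a + (b * a) ^ 2, ?_⟩
    rw [Ideal.mem_bot, mul_assoc, ← hn]
    noncomm_ring

/-- The sum of the coefficients of the socle elements `x² e_j`. -/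
noncomputable def socleForm : AlgA K 0 →ₗ[K] K :=
  (∑ j : Gam, LinearMap.proj j) ∘ₗ coord K 3

lemma socleForm_apply (a : AlgA K 0) : socleForm K a = ∑ j, coord K 3 a j := by
  simp [socleForm]

/-- As `e_i x² = x² e_{i+2}`, left multiplication by `e_i` picks the coefficient of
`x² e_{i+2}`. -/
lemma socleForm_idem_mul (i : Gam) (a : AlgA K 0) :
    socleForm K (idem K i * a) = coord K 3 a (i + 1 + 1) := by
  have hX (j : Gam) (z : AlgA K 0) : idem K j * (genX K * z) = genX K * (idem K (j + 1) * z) := by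
    rw [← mul_assoc, idem_mul_genX, mul_assoc]
  have hY (j : Gam) (z : AlgA K 0) : idem K j * (genY K * z) = genY K * (idem K (j + 1) * z) := by
    rw [← mul_assoc, idem_mul_genY, mul_assoc]
  rw [socleForm_apply]
  conv_lhs => rw [← sum_partProj K a]
  simp [partProj, mul_add, hX, hY, idem_mul_diag, coord_genX_mul, coord_genY_mul, coord_idem,
    Fin.sum_univ_four, matX, matY, Pi.single_apply]

/-- The form `(b, a) ↦ socleForm (b * a)` is nondegenerate: `b = e_i w` with `w` among
`1, x, y, x²` recovers every coordinate of `a`. -/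
lemma eq_zero_of_socleForm {a : AlgA K 0} (ha : ∀ b, socleForm K (b * a) = 0) : a = 0 := by
  have h (w : AlgA K 0) : coord K 3 (w * a) = 0 := by
    funext j
    have := ha (idem K (j - 1 - 1) * w)
    rwa [mul_assoc, socleForm_idem_mul, sub_add_cancel, sub_add_cancel] at this
  have h0 := h (genX K * genX K)
  have h1 := h (genX K)
  have h2 := h (genY K)
  have h3 := h 1
  rw [mul_assoc] at h0
  simp [coord_genX_mul, coord_genY_mul, Fin.sum_univ_four, matX, matY] at h0 h1 h2 h3
  exact (leftCoords K).ext (by simpa [leftCoords] using h0) (by simpa [leftCoords] using h1)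
    (by simpa [leftCoords] using h2) (by simpa [leftCoords] using h3)

lemma finiteDimensional_algA : FiniteDimensional K (AlgA K 0) := by
  refine FiniteDimensional.of_injective (LinearMap.pi (coord K)) fun a b h => ?_
  exact (leftCoords K).ext (congrFun h 0) (congrFun h 1) (congrFun h 2) (congrFun h 3)

lemma isSemisimpleRing_lengthPart_zero : IsSemisimpleRing (lengthPart K 0 0) := by
  let f : (Gam → K) →+* lengthPart K 0 0 :=
    { toFun := fun e => ⟨diag K e, diag_mem K e⟩
      map_one' := Subtype.ext (diag_one K)
      map_mul' := fun e e' => Subtype.ext (diag_mul_diag K e e').symm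
      map_zero' := Subtype.ext (map_zero _)
      map_add' := fun e e' => Subtype.ext (map_add _ _ _) }
  refine f.isSemisimpleRing_of_surjective fun a => ⟨coord K 0 a, Subtype.ext ?_⟩
  exact (partProj_of_mem K 0 0 a.2).trans (if_pos rfl)

end Structure

theorem proposition2p1 (K : Type u) [Field K] [IsAlgClosed K] :
    FiniteDimensional K (AlgA K 0) ∧ IsSelfInjective (AlgA K 0) ∧
    ∃ _ : GradedAlgebra (lengthPart K 0), IsKoszul (lengthPart K 0) ∧
      (Ring.jacobson (AlgA K 0) : Set (AlgA K 0)) = positivePart (lengthPart K 0) := by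
  have := finiteDimensional_algA K
  refine ⟨this, IsSelfInjective.of_linearForm (socleForm K) fun a => eq_zero_of_socleForm K,
    lengthGrading K, ⟨isSemisimpleRing_lengthPart_zero K, ?_⟩, ?_⟩
  · exact ⟨(leftCoords K).linearResolution (lengthPart K 0) (genX_mem K) (genY_mem K) fun a =>
      mem_positivePart K⟩
  · ext a
    rw [SetLike.mem_coe, SetLike.mem_coe, mem_jacobson, mem_positivePart]
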